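/- Let $\overline\Omega$ be a $C^\infty$ compact connected Riemannian manifold of dimension $d\ge 1$ with boundary $\partial\Omega$ and interior $\Omega=\overline\Omega\setminus\partial\Omega$ (for instance the closure of a bounded connected open $C^\infty$ domain of $\mathbb R^d$), let $n(x)$ be the unit outward normal at $x\in\partial\Omega$, and let $f:\overline\Omega\to\mathbb R$ be $C^\infty$. For $x\in\partial\Omega$ let $\partial_nf(x)=\nabla f(x)\cdot n(x)$ and let $\nabla_Tf(x)=\nabla f(x)-(\nabla f(x)\cdot n(x))\,n(x)$ be the tangential gradient. Set $g=|\nabla f|$ on $\Omega$ and $g=|\nabla_Tf|$ on $\partial\Omega$, and define the Agmon distance $$d_a(x,y)=\inf_\gamma\int_0^1 g(\gamma(t))\,|\gamma'(t)|\,dt ,\qquad x,y\in\overline\Omega,$$ where the infimum is over the Lipschitz curves $\gamma:[0,1]\to\overline\Omega$ with $\gamma(0)=x$ and $\gamma(1)=y$. Assume: - **[H1]** $f$ is a Morse function on $\Omega$ (its critical points in $\Omega$ are non-degenerate), $f|_{\partial\Omega}$ is a Morse function on $\partial\Omega$, and $f$ has no critical point on $\partial\Omega$; - **[H3]** $\partial_nf>0$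 on $\partial\Omega$. Let $z_1,\dots,z_n$ be the (pairwise distinct) local minima of $f|_{\partial\Omega}$, ordered such that $f(z_1)\le f(z_2)\le\dots\le f(z_n)$. Then for all $i,j\in\{1,\dots,n\}$ with $i<j$, $$d_a(z_i,z_j)>f(z_j)-f(z_i).$$ -/

import Mathlib

open Set MeasureTheory Bundle
open scoped Manifold ContDiff ENNReal NNReal Topology InnerProductSpace

noncomputable section

namespace Agmon

section Charts

variable (d : ℕ) [NeZero d]
  {M : Type*} [TopologicalSpace M] [ChartedSpace (EuclideanHalfSpace d) M]

/-- The first coordinate of a tangent vector in the preferred chart at its base point. The model is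
the half-space `{v | 0 ≤ v 0}`, so at a boundary point this vanishes exactly on the vectors tangent
to the boundary, and it is negative exactly on the vectors pointing strictly outwards. -/
def inwardCoord (x : M) : TangentSpace (𝓡∂ d) x →ₗ[ℝ] ℝ :=
  (EuclideanSpace.proj (0 : Fin d) : EuclideanSpace ℝ (Fin d) →L[ℝ] ℝ).toLinearMap ∘ₗ
    (mfderiv (𝓡∂ d) 𝓘(ℝ, EuclideanSpace ℝ (Fin d)) (extChartAt (𝓡∂ d) x) x).toLinearMap

/-- For `x` in the boundary: the tangent space at `x` of the boundary, as a hyperplane of the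
tangent space at `x` of the manifold. -/
def boundaryTangent (x : M) : Submodule ℝ (TangentSpace (𝓡∂ d) x) :=
  LinearMap.ker (inwardCoord d x)

/-- The function `f` read in the preferred chart at `x`, translated so that `x` sits at `0`. -/
def localRep (f : M → ℝ) (x : M) : EuclideanSpace ℝ (Fin d) → ℝ :=
  fun v => f ((extChartAt (𝓡∂ d) x).symm (extChartAt (𝓡∂ d) x x + v))

/-- The hyperplane `{v | v 0 = 0}`, on which the boundary is modelled. -/
def boundaryModel : Submodule ℝ (EuclideanSpace ℝ (Fin d)) :=
  LinearMap.ker (EuclideanSpace.proj (0 : Fin d) : EuclideanSpace ℝ (Fin d) →L[ℝ] ℝ).toLinearMap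

/-- For `x` in the boundary: the restriction of `f` to the boundary, read in the chart of the
boundary at `x` induced by the preferred chart at `x`, translated so that `x` sits at `0`. -/
def boundaryLocalRep (f : M → ℝ) (x : M) : boundaryModel d → ℝ :=
  fun v => localRep d f x v

theorem inwardCoord_ne_zero [IsManifold (𝓡∂ d) 1 M] (x : M) : inwardCoord d x ≠ 0 := by
  intro h
  have h1 := LinearMap.congr_fun h (EuclideanSpace.single (0 : Fin d) (1 : ℝ))
  simp only [inwardCoord, mfderiv_extChartAt_self] at h1
  have h2 : (EuclideanSpace.single (0 : Fin d) (1 : ℝ) : EuclideanSpace ℝ (Fin d)) 0 = 0 := h1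
  simp at h2

end Charts

/-- If `0` is a critical point of `φ`, then the Hessian of `φ` at `0` is non-degenerate. -/
def IsMorseAtZero {V : Type*} [NormedAddCommGroup V] [NormedSpace ℝ V] (φ : V → ℝ) : Prop :=
  fderiv ℝ φ 0 = 0 → ∀ v : V, (∀ w : V, fderiv ℝ (fderiv ℝ φ) 0 v w = 0) → v = 0

section Hypotheses

variable (d : ℕ) [NeZero d]
  {M : Type*} [TopologicalSpace M] [ChartedSpace (EuclideanHalfSpace d) M]

/-- `f` is a Morse function in the interior of the manifold, its restriction to the boundary is a
Morse function, and `f` has no critical point on the boundary. -/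
structure HypH1 (f : M → ℝ) : Prop where
  morse_interior : ∀ x ∈ (𝓡∂ d).interior M, IsMorseAtZero (localRep d f x)
  morse_boundary : ∀ x ∈ (𝓡∂ d).boundary M, IsMorseAtZero (boundaryLocalRep d f x)
  no_critical_boundary : ∀ x ∈ (𝓡∂ d).boundary M, mfderiv (𝓡∂ d) 𝓘(ℝ, ℝ) f x ≠ 0

/-- The set of the local minima of the restriction of `f` to the boundary. -/
def boundaryLocalMinima (f : M → ℝ) : Set M :=
  {z | z ∈ (𝓡∂ d).boundary M ∧ IsLocalMinOn f ((𝓡∂ d).boundary M) z}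

end Hypotheses

section Riemannian

variable (d : ℕ) [NeZero d]
  {M : Type*} [TopologicalSpace M] [ChartedSpace (EuclideanHalfSpace d) M]
  [IsManifold (𝓡∂ d) ∞ M] [RiemannianBundle (fun x : M => TangentSpace (𝓡∂ d) x)]

/-- For `x` in the boundary: `n` is the unit outward normal to the boundary at `x`. -/
structure IsOutwardUnitNormal (x : M) (n : TangentSpace (𝓡∂ d) x) : Prop where
  norm_eq_one : ‖n‖ = 1
  orthogonal : ∀ v ∈ boundaryTangent d x, ⟪n, v⟫_ℝ = 0
  outward : inwardCoord d x n < 0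

instance (x : M) : FiniteDimensional ℝ (TangentSpace (𝓡∂ d) x) :=
  inferInstanceAs (FiniteDimensional ℝ (EuclideanSpace ℝ (Fin d)))

instance (x : M) : CompleteSpace (TangentSpace (𝓡∂ d) x) := FiniteDimensional.complete ℝ _

theorem existsUnique_outwardUnitNormal (x : M) :
    ∃! n : TangentSpace (𝓡∂ d) x, IsOutwardUnitNormal d x n := by
  set l : TangentSpace (𝓡∂ d) x →L[ℝ] ℝ := LinearMap.toContinuousLinearMap (inwardCoord d x)
  have hl : ∀ v, l v = inwardCoord d x v := fun v => rfl
  set w := (InnerProductSpace.toDual ℝ (TangentSpace (𝓡∂ d) x)).symm l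
  have hw : ∀ v, ⟪w, v⟫_ℝ = inwardCoord d x v := fun v => by
    rw [← hl]; exact InnerProductSpace.toDual_symm_apply
  have hw0 : w ≠ 0 := by
    intro h
    refine inwardCoord_ne_zero d x (LinearMap.ext fun v => ?_)
    rw [← hw v, h, inner_zero_left, LinearMap.zero_apply]
  have hn : 0 < ‖w‖ := norm_pos_iff.2 hw0
  refine ⟨-(‖w‖⁻¹ • w), ⟨?_, ?_, ?_⟩, ?_⟩
  · rw [norm_neg, norm_smul, norm_inv, norm_norm, inv_mul_cancel₀ hn.ne']
  · intro v hv
    have hv' : inwardCoord d x v = 0 := hv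
    rw [inner_neg_left, real_inner_smul_left, hw, hv', mul_zero, neg_zero]
  · rw [map_neg, map_smul, ← hw w, real_inner_self_eq_norm_sq, smul_eq_mul, neg_lt_zero]
    positivity
  · rintro m ⟨hm1, hm2, hm3⟩
    set c : ℝ := inwardCoord d x m / ‖w‖ ^ 2 with hc
    have hww : inwardCoord d x w = ‖w‖ ^ 2 := by rw [← hw w, real_inner_self_eq_norm_sq]
    have hc0 : c < 0 := div_neg_of_neg_of_pos hm3 (by positivity)
    have hker : m - c • w ∈ boundaryTangent d x := by
      change inwardCoord d x (m - c • w) = 0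
      rw [map_sub, map_smul, hww, smul_eq_mul, hc, div_mul_cancel₀ _ (by positivity), sub_self]
    have hz : m - c • w = 0 := by
      rw [← inner_self_eq_zero (𝕜 := ℝ), inner_sub_left, hm2 _ hker, real_inner_smul_left, hw]
      have : inwardCoord d x (m - c • w) = 0 := hker
      rw [this, mul_zero, sub_zero]
    have hmc : m = c • w := sub_eq_zero.1 hz
    have hcw : -c * ‖w‖ = 1 := by
      rw [hmc, norm_smul, Real.norm_of_nonpos hc0.le] at hm1
      exact hm1
    have : c = -‖w‖⁻¹ := by
      rw [eq_neg_iff_add_eq_zero, ← neg_eq_iff_add_eq_zero]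
      exact eq_inv_of_mul_eq_one_left hcw
    rw [hmc, this, neg_smul]

/-- The unit outward normal to the boundary at a boundary point `x`. -/
def outwardNormal (x : M) : TangentSpace (𝓡∂ d) x :=
  (existsUnique_outwardUnitNormal d x).choose

/-- The differential of `f` at `x`, as a linear form on the tangent space at `x`. -/
def differential (f : M → ℝ) (x : M) : TangentSpace (𝓡∂ d) x →L[ℝ] ℝ :=
  mfderiv (𝓡∂ d) 𝓘(ℝ, ℝ) f x

/-- The Riemannian gradient of `f`. -/
def gradient (f : M → ℝ) (x : M) : TangentSpace (𝓡∂ d) x :=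
  (InnerProductSpace.toDual ℝ (TangentSpace (𝓡∂ d) x)).symm (differential d f x)

/-- The normal derivative of `f` at a boundary point `x`. -/
def normalDeriv (f : M → ℝ) (x : M) : ℝ :=
  ⟪gradient d f x, outwardNormal d x⟫_ℝ

/-- The tangential gradient of `f` at a boundary point `x`. -/
def tangentialGradient (f : M → ℝ) (x : M) : TangentSpace (𝓡∂ d) x :=
  gradient d f x - normalDeriv d f x • outwardNormal d x

/-- The normal derivative of `f` is positive on the boundary. -/
def HypH3 (f : M → ℝ) : Prop :=
  ∀ x ∈ (𝓡∂ d).boundary M, 0 < normalDeriv d f x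

open Classical in
/-- The norm of the gradient inside the manifold, and of the tangential gradient on its boundary. -/
def agmonWeight (f : M → ℝ) (x : M) : ℝ :=
  if x ∈ (𝓡∂ d).boundary M then ‖tangentialGradient d f x‖ else ‖gradient d f x‖

/-- The Agmon length, with values in `[0, ∞]`, of a curve `γ` over a set `s` of times. -/
def agmonLength (f : M → ℝ) (γ : ℝ → M) (s : Set ℝ) : ℝ≥0∞ :=
  ∫⁻ t in s, ENNReal.ofReal (agmonWeight d f (γ t) * ‖mfderiv 𝓘(ℝ, ℝ) (𝓡∂ d) γ t 1‖)

end Riemannian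

section Distance

variable (d : ℕ) [NeZero d]
  {M : Type*} [MetricSpace M] [ChartedSpace (EuclideanHalfSpace d) M]
  [IsManifold (𝓡∂ d) ∞ M] [RiemannianBundle (fun x : M => TangentSpace (𝓡∂ d) x)]

/-- The curves which are Lipschitz on `[0, 1]`, start from `x` and end at `y`. Such a curve is
represented by a function on `ℝ`, of which only the values on `[0, 1]` matter. -/
def LipCurves (x y : M) : Set (ℝ → M) :=
  {γ | (∃ K : ℝ≥0, LipschitzOnWith K γ (Icc 0 1)) ∧ γ 0 = x ∧ γ 1 = y}

/-- The Agmon distance, with values in `[0, ∞]`. -/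
def agmonDist (f : M → ℝ) (x y : M) : ℝ≥0∞ :=
  ⨅ γ ∈ LipCurves x y, agmonLength d f γ (Ioo 0 1)

end Distance

end Agmon

end

/-!
The inequality is obtained by calibration. If `φ` is a `C¹` function whose differential is bounded
by `‖∇f‖` at interior points, and by `‖∇_T f‖` on the vectors tangent to the boundary at boundary
points, then `φ y - φ x ≤ d_a(x, y)` (`Agmon.ofReal_sub_le_agmonDist`): along a Lipschitz curve `γ`
the function `φ ∘ γ` is the integral of its derivative, and at almost every time the curve is
differentiable, with velocity tangent to the boundary whenever the curve is on the boundary. The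
function `f` itself is such a calibration, which only gives the weak inequality. For distinct local
minima `w` and `z` of `f` on the boundary, `Agmon.exists_calibration` provides a calibration `φ` with
`φ z - φ w > f z - f w`.

The reason for the gain is that a curve from `w` to `z` without excess cost would have to follow
gradient lines upwards. Since `∂ₙf > 0`, gradient lines exit through the boundary, so that this curve
could never leave the boundary, and it could not reach `z` along the boundary either, because `z` is
a strict local minimum there. Accordingly, let `s` be a boundary defining function (smooth,
nonnegative, vanishing exactly on the boundary, with nonzero differential there), and
`φ = f - ((δ - s - η)₊)²`, where `η = ((f z + ε - f)₊)²` on a small ball around `z` and `η = 0`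
elsewhere. The term `s` penalizes leaving the boundary, the term `η` penalizes approaching `z`, and
`φ = f` at depth `s ≥ δ`. On the sphere bounding the ball either `f > f z + ε`, where `η` vanishes, or
`s` is bounded below, where `φ = f`; so the cut-off of `η` does not destroy the regularity of `φ`. One
has `dφ = k df + a ds` with `1/2 ≤ k ≤ 1` and `0 ≤ a ≤ 2δ`. On boundary-tangent vectors `ds` vanishes,
and the bound is clear. Near the boundary `⟨∇s, ∇f⟩` is negative, as `∇s` is an inward normal and
`∂ₙf > 0`, so that `‖k ∇f + a ∇s‖ ≤ ‖∇f‖` for small `δ`. Finally `φ w = f w - δ²`, whereas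
`φ z > f z - δ²`.
-/

namespace Agmon

/-! ### Norm of the differential and Lipschitz continuity of `C¹` functions -/

section Differential

variable {d : ℕ} [NeZero d]

/-- The norm of a covector at `y` is compared with that of the same covector transported to the
fixed tangent space at `x₀` by the trivialization of the tangent bundle at `x₀`: the transport maps
have norms close to one when `y` is close to `x₀`, because the metric is continuous. -/
theorem continuous_norm_differential
    {M : Type*} [TopologicalSpace M] [ChartedSpace (EuclideanHalfSpace d) M]
    [IsManifold (𝓡∂ d) ∞ M] [RiemannianBundle (fun x : M => TangentSpace (𝓡∂ d) x)]
    [IsContinuousRiemannianBundle (EuclideanSpace ℝ (Fin d))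
      (fun x : M => TangentSpace (𝓡∂ d) x)]
    {u : M → ℝ} (hu : ContMDiff (𝓡∂ d) 𝓘(ℝ, ℝ) 1 u) :
    Continuous (fun x => ‖differential d u x‖) := by
  have : IsManifold (𝓡∂ d) 1 M := IsManifold.of_le (n := ∞) (by simp)
  rw [continuous_iff_continuousAt]
  intro x₀
  let T := trivializationAt (EuclideanSpace ℝ (Fin d)) (fun x : M => TangentSpace (𝓡∂ d) x) x₀
  have hx₀ : x₀ ∈ T.baseSet := FiberBundle.mem_baseSet_trivializationAt' x₀
  have hT : ∀ᶠ y in 𝓝 x₀, y ∈ T.baseSet := T.open_baseSet.mem_nhds hx₀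
  have hcont : ContinuousAt (fun y => (differential d u y ∘L T.symmL ℝ y :
      EuclideanSpace ℝ (Fin d) →L[ℝ] ℝ)) x₀ := by
    have h := ((hu x₀).mfderiv_const (m := 0) (by simp)).continuousAt
    refine h.congr ?_
    filter_upwards [hT] with y hy
    ext v
    simp [inTangentCoordinates, ContinuousLinearMap.inCoordinates, differential, T]
    rfl
  -- The differential at `y` as a covector at `x₀`.
  let G : M → (TangentSpace (𝓡∂ d) x₀ →L[ℝ] ℝ) := fun y =>
    (differential d u y ∘L T.symmL ℝ y : EuclideanSpace ℝ (Fin d) →L[ℝ] ℝ) ∘L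
      T.continuousLinearMapAt ℝ x₀
  have hG : ContinuousAt (fun y => ‖G y‖) x₀ := (hcont.clm_comp continuousAt_const).norm
  have hG₀ : G x₀ = differential d u x₀ := by
    ext v
    simp only [G, ContinuousLinearMap.comp_apply]
    congr 1
    exact T.symmL_continuousLinearMapAt hx₀ v
  have hle : ∀ r : ℝ, 1 < r → ∀ᶠ y in 𝓝 x₀,
      ‖G y‖ ≤ ‖differential d u y‖ * r ∧ ‖differential d u y‖ ≤ ‖G y‖ * r := by
    intro r hr
    filter_upwards [hT,
      eventually_norm_symmL_trivializationAt_comp_self_lt (EuclideanSpace ℝ (Fin d))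
        (fun x : M => TangentSpace (𝓡∂ d) x) x₀ hr,
      eventually_norm_symmL_trivializationAt_self_comp_lt (EuclideanSpace ℝ (Fin d))
        (fun x : M => TangentSpace (𝓡∂ d) x) x₀ hr] with y hy h₁ h₂
    constructor
    · refine (ContinuousLinearMap.opNorm_comp_le (differential d u y)
        (T.symmL ℝ y ∘L T.continuousLinearMapAt ℝ x₀)).trans ?_
      gcongr
    · have hdu : differential d u y = G y ∘L (T.symmL ℝ x₀ ∘L T.continuousLinearMapAt ℝ y) := by
        ext v
        simp only [G, ContinuousLinearMap.comp_apply]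
        erw [T.continuousLinearMapAt_symmL hx₀, T.symmL_continuousLinearMapAt hy]
      rw [hdu]
      refine (ContinuousLinearMap.opNorm_comp_le _ _).trans ?_
      exact mul_le_mul_of_nonneg_left h₂.le (norm_nonneg _)
  have hmul : ∀ a : ℝ, Filter.Tendsto (fun r : ℝ => a * r) (𝓝[>] 1) (𝓝 a) := fun a =>
    ((continuous_const.mul continuous_id).tendsto' 1 a (by simp)).mono_left nhdsWithin_le_nhds
  change Filter.Tendsto _ _ _
  rw [tendsto_order]
  constructor
  · intro a ha
    obtain ⟨r, har, hr⟩ := (((hmul a).eventually_lt_const ha).and self_mem_nhdsWithin).exists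
    have hr1 : (1 : ℝ) < r := hr
    filter_upwards [hle r hr1, hG.eventually_const_lt (u := a * r) (by simpa only [hG₀] using har)] with y h₁ h₂
    exact lt_of_mul_lt_mul_right (h₂.trans_le h₁.1) (by linarith)
  · intro b hb
    obtain ⟨r, hbr, hr⟩ := (((hmul ‖differential d u x₀‖).eventually_lt_const hb).and
      self_mem_nhdsWithin).exists
    have hr1 : (1 : ℝ) < r := hr
    have hGr : ContinuousAt (fun y => ‖G y‖ * r) x₀ := hG.mul continuousAt_const
    filter_upwards [hle r hr1, hGr.eventually_lt_const (u := b) (by simpa only [hG₀] using hbr)] with y h₁ h₂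
    exact h₁.2.trans_lt h₂

/-- Along a `C¹` path the variation of `u` is at most the bound on its differential times the
length of the path, and the distance of a Riemannian manifold is the infimum of these lengths. -/
theorem exists_lipschitzWith
    {M : Type*} [MetricSpace M] [CompactSpace M] [ChartedSpace (EuclideanHalfSpace d) M]
    [IsManifold (𝓡∂ d) ∞ M] [RiemannianBundle (fun x : M => TangentSpace (𝓡∂ d) x)]
    [IsContinuousRiemannianBundle (EuclideanSpace ℝ (Fin d))
      (fun x : M => TangentSpace (𝓡∂ d) x)]
    [IsRiemannianManifold (𝓡∂ d) M]
    {u : M → ℝ} (hu : ContMDiff (𝓡∂ d) 𝓘(ℝ, ℝ) 1 u) :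
    ∃ K : ℝ≥0, LipschitzWith K u := by
  obtain ⟨C, hC⟩ := (isCompact_univ (X := M)).bddAbove_image
    (continuous_norm_differential hu).continuousOn
  -- The constant is made positive, since it is divided by below.
  obtain ⟨K, hK⟩ : ∃ K : ℝ≥0, K = C.toNNReal + 1 := ⟨_, rfl⟩
  have hK0 : K ≠ 0 := by rw [hK]; positivity
  have hC' : ∀ x, ‖differential d u x‖ ≤ K := fun x => by
    have h₁ := (hC ⟨x, mem_univ x, rfl⟩).trans (Real.le_coe_toNNReal C)
    rw [hK, NNReal.coe_add, NNReal.coe_one]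
    linarith
  refine ⟨K, fun x y => ?_⟩
  rw [mul_comm, ← ENNReal.div_le_iff (by simpa using hK0) (by simp),
    IsRiemannianManifold.out (I := 𝓡∂ d) x y]
  refine le_of_forall_gt fun r hr => ?_
  obtain ⟨γ, hγ0, hγ1, hγ, hlen⟩ := Manifold.exists_lt_of_riemannianEDist_lt hr
  refine lt_of_le_of_lt ?_ hlen
  rw [ENNReal.div_le_iff (by simpa using hK0) (by simp),
    Manifold.pathELength_eq_lintegral_mfderivWithin_Icc, edist_comm]
  have hcomp : ContDiffOn ℝ 1 (u ∘ γ) (Icc 0 1) :=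
    contMDiffOn_iff_contDiffOn.mp (hu.comp_contMDiffOn hγ)
  calc edist (u y) (u x) = ‖(u ∘ γ) 1 - (u ∘ γ) 0‖ₑ := by
        rw [edist_eq_enorm_sub, Function.comp_apply, Function.comp_apply, hγ0, hγ1]
    _ ≤ ∫⁻ t in Icc 0 1, ‖derivWithin (u ∘ γ) (Icc 0 1) t‖ₑ :=
        enorm_sub_le_lintegral_derivWithin_Icc_of_contDiffOn_Icc hcomp zero_le_one
    _ ≤ ∫⁻ t in Icc (0 : ℝ) 1, K * ‖mfderivWithin 𝓘(ℝ, ℝ) (𝓡∂ d) γ (Icc 0 1) t 1‖ₑ := by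
        refine setLIntegral_mono' measurableSet_Icc fun t ht => ?_
        have hd : derivWithin (u ∘ γ) (Icc 0 1) t =
            differential d u (γ t) (mfderivWithin 𝓘(ℝ, ℝ) (𝓡∂ d) γ (Icc 0 1) t 1) := by
          rw [← fderivWithin_derivWithin, ← mfderivWithin_eq_fderivWithin,
            mfderiv_comp_mfderivWithin t ((hu _).mdifferentiableAt one_ne_zero)
              ((hγ t ht).mdifferentiableWithinAt one_ne_zero)
              ((uniqueDiffOn_Icc zero_lt_one).uniqueMDiffOn t ht)]
          rfl
        rw [hd]
        refine (ContinuousLinearMap.le_opENorm _ _).trans ?_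
        gcongr
        rw [← ofReal_norm, ← ENNReal.ofReal_coe_nnreal]
        exact ENNReal.ofReal_le_ofReal (hC' _)
    _ = K * ∫⁻ t in Icc (0 : ℝ) 1,
          ‖mfderivWithin 𝓘(ℝ, ℝ) (𝓡∂ d) γ (Icc 0 1) t 1‖ₑ :=
        lintegral_const_mul' _ _ (by simp)
    _ = _ := mul_comm _ _

end Differential

/-! ### Cut-off chart coordinates and differentiability of Lipschitz curves -/

section BumpCoordinates

variable {d : ℕ} [NeZero d]

/-- The `i`-th coordinate of the chart at `x`, cut off by a bump function at `x`. -/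
noncomputable def bumpCoord {M : Type*} [TopologicalSpace M] [ChartedSpace (EuclideanHalfSpace d) M]
    {x : M} (ρ : SmoothBumpFunction (𝓡∂ d) x) (i : Fin d) (y : M) : ℝ :=
  ρ y * extChartAt (𝓡∂ d) x y i

/-- The open set of the points near which a bump function is identically one. -/
def plateau {M : Type*} [TopologicalSpace M] [ChartedSpace (EuclideanHalfSpace d) M]
    {x : M} (ρ : SmoothBumpFunction (𝓡∂ d) x) : Set M :=
  {y | ∀ᶠ y' in 𝓝 y, ρ y' = 1}

section

variable {M : Type*} [TopologicalSpace M] [ChartedSpace (EuclideanHalfSpace d) M]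
  {x : M} (ρ : SmoothBumpFunction (𝓡∂ d) x)

theorem isOpen_plateau : IsOpen (plateau ρ) := isOpen_setOfPred_eventually_nhds

theorem plateau_subset_source : plateau ρ ⊆ (chartAt (EuclideanHalfSpace d) x).source := by
  intro y hy
  apply ρ.support_subset_source
  rw [Function.mem_support, Filter.Eventually.self_of_nhds hy]
  exact one_ne_zero

theorem bumpCoord_eventuallyEq {y : M} (hy : y ∈ plateau ρ) (i : Fin d) :
    bumpCoord ρ i =ᶠ[𝓝 y] fun y' => extChartAt (𝓡∂ d) x y' i := by
  filter_upwards [hy] with y' hy'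
  rw [bumpCoord, hy', one_mul]

theorem contMDiff_bumpCoord [T2Space M] [IsManifold (𝓡∂ d) ∞ M] (i : Fin d) :
    ContMDiff (𝓡∂ d) 𝓘(ℝ, ℝ) ∞ (bumpCoord ρ i) := by
  refine ρ.contMDiff_smul (g := fun y => extChartAt (𝓡∂ d) x y i) ?_
  exact (EuclideanSpace.proj i : EuclideanSpace ℝ (Fin d) →L[ℝ] ℝ).contMDiff.comp_contMDiffOn
    contMDiffOn_extChartAt

end

/-- A compact manifold is covered by the plateaus of finitely many bump functions. -/
theorem exists_finite_plateau_cover {M : Type*} [TopologicalSpace M] [CompactSpace M]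
    [ChartedSpace (EuclideanHalfSpace d) M]
    (ρ : ∀ x : M, SmoothBumpFunction (𝓡∂ d) x) :
    ∃ c : Finset M, ∀ y, ∃ x ∈ c, y ∈ plateau (ρ x) := by
  obtain ⟨c, -, hc⟩ := isCompact_univ.elim_nhds_subcover (fun x => plateau (ρ x))
    fun x _ => (isOpen_plateau (ρ x)).mem_nhds (ρ x).eventuallyEq_one.eventually
  exact ⟨c, fun y => by simpa using hc (mem_univ y)⟩

end BumpCoordinates

section Curves

variable {d : ℕ} [NeZero d] {M : Type*} [MetricSpace M] [CompactSpace M]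
  [ChartedSpace (EuclideanHalfSpace d) M]
  [IsManifold (𝓡∂ d) ∞ M] [RiemannianBundle (fun x : M => TangentSpace (𝓡∂ d) x)]
  [IsContinuousRiemannianBundle (EuclideanSpace ℝ (Fin d))
    (fun x : M => TangentSpace (𝓡∂ d) x)]
  [IsRiemannianManifold (𝓡∂ d) M]

/-- The cut-off coordinates are globally Lipschitz, so that their compositions with the curve are
differentiable almost everywhere. -/
theorem ae_mdifferentiableAt_of_lipschitzOnWith {γ : ℝ → M} {K : ℝ≥0}
    (hγ : LipschitzOnWith K γ (Icc 0 1)) :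
    ∀ᵐ t : ℝ, t ∈ Ioo (0 : ℝ) 1 → MDifferentiableAt 𝓘(ℝ, ℝ) (𝓡∂ d) γ t := by
  have : IsManifold (𝓡∂ d) 1 M := IsManifold.of_le (n := ∞) (by simp)
  have ρ : ∀ x : M, SmoothBumpFunction (𝓡∂ d) x := fun x => Classical.arbitrary _
  obtain ⟨c, hc⟩ := exists_finite_plateau_cover ρ
  have hae : ∀ᵐ t : ℝ, ∀ x ∈ c, ∀ i, t ∈ Ioo (0 : ℝ) 1 →
      DifferentiableAt ℝ (bumpCoord (ρ x) i ∘ γ) t := by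
    refine (Filter.eventually_all_finset c).2 fun x _ => ae_all_iff.2 fun i => ?_
    obtain ⟨C, hC⟩ := exists_lipschitzWith ((contMDiff_bumpCoord (ρ x) i).of_le (by simp))
    have hL : LipschitzOnWith (C * K) (bumpCoord (ρ x) i ∘ γ) (Ioo 0 1) :=
      hC.comp_lipschitzOnWith (hγ.mono Ioo_subset_Icc_self)
    filter_upwards [hL.ae_differentiableWithinAt_of_mem_real] with t ht h
    exact (ht h).differentiableAt (Ioo_mem_nhds h.1 h.2)
  filter_upwards [hae] with t ht h
  have hγt : ContinuousAt γ t := hγ.continuousOn.continuousAt (Icc_mem_nhds h.1 h.2)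
  obtain ⟨x, hx, hp⟩ := hc (γ t)
  rw [mdifferentiableAt_iff_target_of_mem_source (plateau_subset_source _ hp)]
  refine ⟨hγt, ?_⟩
  rw [mdifferentiableAt_iff_differentiableAt, differentiableAt_euclidean]
  intro i
  refine (ht x hx i h).congr_of_eventuallyEq ?_
  exact ((hγt.eventually (bumpCoord_eventuallyEq (ρ x) hp i)).mono fun _ h => h.symm)

end Curves

/-! ### Boundary defining functions -/

section Boundary

variable {d : ℕ} [NeZero d] {M : Type*} [TopologicalSpace M]
  [ChartedSpace (EuclideanHalfSpace d) M]

theorem differential_add [IsManifold (𝓡∂ d) ∞ M]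
    [RiemannianBundle (fun x : M => TangentSpace (𝓡∂ d) x)] {u v : M → ℝ} {y : M}
    (hu : MDifferentiableAt (𝓡∂ d) 𝓘(ℝ, ℝ) u y) (hv : MDifferentiableAt (𝓡∂ d) 𝓘(ℝ, ℝ) v y) :
    differential d (fun y => u y + v y) y = differential d u y + differential d v y :=
  (hu.hasMFDerivAt.add hv.hasMFDerivAt).mfderiv

theorem differential_comp_of_hasDerivAt [IsManifold (𝓡∂ d) ∞ M]
    [RiemannianBundle (fun x : M => TangentSpace (𝓡∂ d) x)] {h : ℝ → ℝ} {h' : ℝ} {u : M → ℝ}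
    {y : M} (hh : HasDerivAt h h' (u y)) (hu : MDifferentiableAt (𝓡∂ d) 𝓘(ℝ, ℝ) u y) :
    differential d (fun y => h (u y)) y = h' • differential d u y := by
  ext v
  have hm := (HasMFDerivAt.comp y hh.hasFDerivAt.hasMFDerivAt hu.hasMFDerivAt).mfderiv
  refine (DFunLike.congr_fun hm v).trans ?_
  exact mul_comm (differential d u y v) h'

theorem differential_finsetSum [IsManifold (𝓡∂ d) ∞ M]
    [RiemannianBundle (fun x : M => TangentSpace (𝓡∂ d) x)] {ι : Type*} (c : Finset ι)
    {u : ι → M → ℝ} {y : M} (hu : ∀ i ∈ c, MDifferentiableAt (𝓡∂ d) 𝓘(ℝ, ℝ) (u i) y) :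
    differential d (fun y => ∑ i ∈ c, u i y) y = ∑ i ∈ c, differential d (u i) y := by
  suffices h : MDifferentiableAt (𝓡∂ d) 𝓘(ℝ, ℝ) (fun y => ∑ i ∈ c, u i y) y ∧
      differential d (fun y => ∑ i ∈ c, u i y) y = ∑ i ∈ c, differential d (u i) y from h.2
  classical
  induction c using Finset.induction_on with
  | empty =>
    simp only [Finset.sum_empty]
    exact ⟨mdifferentiableAt_const, mfderiv_const⟩
  | insert i c hi ih =>
    obtain ⟨h₁, h₂⟩ := ih fun j hj => hu j (Finset.mem_insert_of_mem hj)
    have h₃ := hu i (Finset.mem_insert_self i c)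
    simp only [Finset.sum_insert hi]
    exact ⟨h₃.add h₁, by rw [differential_add h₃ h₁, h₂]⟩

theorem extChartAt_zero_nonneg (x y : M) : 0 ≤ extChartAt (𝓡∂ d) x y 0 := by
  have h : extChartAt (𝓡∂ d) x y ∈ range (𝓡∂ d) := mem_range_self _
  rwa [range_modelWithCornersEuclideanHalfSpace] at h

theorem bumpCoord_zero_nonneg {x : M} (ρ : SmoothBumpFunction (𝓡∂ d) x) (y : M) :
    0 ≤ bumpCoord ρ 0 y :=
  mul_nonneg ρ.nonneg (extChartAt_zero_nonneg x y)

theorem extChartAt_zero_eq_zero_iff [IsManifold (𝓡∂ d) ∞ M] {x y : M}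
    (hy : y ∈ (chartAt (EuclideanHalfSpace d) x).source) :
    extChartAt (𝓡∂ d) x y 0 = 0 ↔ y ∈ (𝓡∂ d).boundary M := by
  have hint : y ∈ (𝓡∂ d).interior M ↔ 0 < extChartAt (𝓡∂ d) x y 0 := by
    have h := ModelWithCorners.isInteriorPoint_iff_of_mem_atlas (I := 𝓡∂ d) (n := ∞) (by simp)
      (chart_mem_atlas (EuclideanHalfSpace d) x) hy
    have hr : extChartAt (𝓡∂ d) x y ∈ interior (range (𝓡∂ d)) ↔ 0 < extChartAt (𝓡∂ d) x y 0 := by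
      rw [interior_range_modelWithCornersEuclideanHalfSpace]
      rfl
    rw [← hr]
    refine h.trans ⟨fun h' => ?_, fun h' => ?_⟩
    · exact OpenPartialHomeomorph.interior_extend_target_subset_interior_range _ h'
    · exact OpenPartialHomeomorph.mem_interior_extend_target _
        ((chartAt (EuclideanHalfSpace d) x).map_source hy) h'
  rw [← ModelWithCorners.compl_interior, mem_compl_iff, hint, not_lt]
  exact ⟨fun h => h.le, fun h => le_antisymm h (extChartAt_zero_nonneg x y)⟩

theorem bumpCoord_zero_eq_zero [IsManifold (𝓡∂ d) ∞ M] {x : M}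
    (ρ : SmoothBumpFunction (𝓡∂ d) x) {y : M} (hy : y ∈ (𝓡∂ d).boundary M) :
    bumpCoord ρ 0 y = 0 := by
  by_cases h : y ∈ (chartAt (EuclideanHalfSpace d) x).source
  · rw [bumpCoord, (extChartAt_zero_eq_zero_iff h).2 hy, mul_zero]
  · have hρ : ρ y = 0 := by
      by_contra h0
      exact h (ρ.support_subset_source h0)
    rw [bumpCoord, hρ, zero_mul]

theorem inwardCoord_apply [IsManifold (𝓡∂ d) ∞ M] (y : M) (v : EuclideanSpace ℝ (Fin d)) :
    inwardCoord d y v = v 0 := by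
  have : IsManifold (𝓡∂ d) 1 M := IsManifold.of_le (n := ∞) (by simp)
  simp only [inwardCoord, mfderiv_extChartAt_self]
  rfl

/-- At a boundary point where `u` attains its minimum the differential of `u` is nonnegative on the
half-space of the inward directions; such linear forms are the nonnegative multiples of
`inwardCoord`. -/
theorem exists_differential_eq_mul_inwardCoord [IsManifold (𝓡∂ d) ∞ M]
    [RiemannianBundle (fun x : M => TangentSpace (𝓡∂ d) x)] {u : M → ℝ} {y : M}
    (hy : y ∈ (𝓡∂ d).boundary M) (hu : MDifferentiableAt (𝓡∂ d) 𝓘(ℝ, ℝ) u y)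
    (hmin : ∀ y', u y ≤ u y') :
    ∃ c : ℝ, 0 ≤ c ∧ ∀ v, differential d u y v = c * inwardCoord d y v := by
  have hD := hu.hasMFDerivAt.2
  set e := extChartAt (𝓡∂ d) y y with he
  have he0 : e 0 = 0 := (extChartAt_zero_eq_zero_iff (mem_chart_source _ y)).2 hy
  let D : EuclideanSpace ℝ (Fin d) →L[ℝ] ℝ := differential d u y
  have hnn : ∀ v : EuclideanSpace ℝ (Fin d), 0 ≤ v 0 → 0 ≤ D v := by
    intro v hv
    have hloc : IsLocalMinOn (writtenInExtChartAt (𝓡∂ d) 𝓘(ℝ, ℝ) y u) (range (𝓡∂ d)) e := by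
      refine Filter.Eventually.of_forall fun z => ?_
      change u ((extChartAt (𝓡∂ d) y).symm e) ≤ u ((extChartAt (𝓡∂ d) y).symm z)
      rw [he, extChartAt_to_inv]
      exact hmin _
    refine hloc.hasFDerivWithinAt_nonneg hD ?_
    refine mem_posTangentConeAt_of_segment_subset ?_
    refine (𝓡∂ d).convex_range.segment_subset (mem_range_self _) ?_
    rw [range_modelWithCornersEuclideanHalfSpace]
    change 0 ≤ (e + v) 0
    simpa [he0] using hv
  have hker : ∀ v : EuclideanSpace ℝ (Fin d), v 0 = 0 → D v = 0 := by
    intro v hv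
    have h₂ := hnn (-v) (by simp [hv])
    rw [map_neg] at h₂
    exact le_antisymm (by linarith) (hnn v hv.ge)
  let e₀ : EuclideanSpace ℝ (Fin d) := EuclideanSpace.single 0 1
  have he₀ : e₀ 0 = 1 := by simp [e₀]
  refine ⟨D e₀, hnn e₀ (by simp [he₀]), fun v => ?_⟩
  let w : EuclideanSpace ℝ (Fin d) := v
  have h := hker (w - w 0 • e₀) (by simp [he₀])
  rw [map_sub, map_smul, smul_eq_mul] at h
  rw [inwardCoord_apply y w, mul_comm]
  exact sub_eq_zero.1 h

theorem differential_bumpCoord_ne_zero [IsManifold (𝓡∂ d) ∞ M]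
    [RiemannianBundle (fun x : M => TangentSpace (𝓡∂ d) x)] {x : M}
    (ρ : SmoothBumpFunction (𝓡∂ d) x) {y : M} (hy : y ∈ plateau ρ) (i : Fin d) :
    differential d (bumpCoord ρ i) y ≠ 0 := by
  have : IsManifold (𝓡∂ d) 1 M := IsManifold.of_le (n := ∞) (by simp)
  intro h
  have hsrc := plateau_subset_source ρ hy
  let pr : EuclideanSpace ℝ (Fin d) →L[ℝ] ℝ := EuclideanSpace.proj i
  have hd : differential d (bumpCoord ρ i) y =
      pr ∘L mfderiv (𝓡∂ d) 𝓘(ℝ, EuclideanSpace ℝ (Fin d)) (extChartAt (𝓡∂ d) x) y := by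
    rw [differential, (bumpCoord_eventuallyEq ρ hy i).mfderiv_eq]
    exact (pr.hasMFDerivAt.comp y (mdifferentiableAt_extChartAt hsrc).hasMFDerivAt).mfderiv
  obtain ⟨v, hv⟩ := (isInvertible_mfderiv_extChartAt (I := 𝓡∂ d) (x := x) (y := y)
    (by rwa [extChartAt_source])).bijective.2 (EuclideanSpace.single i (1 : ℝ))
  have h1 : differential d (bumpCoord ρ i) y v = 1 := by
    rw [hd]
    refine (congrArg pr hv).trans ?_
    simp [pr]
  rw [h] at h1
  exact zero_ne_one h1

/-- A boundary defining function: a smooth nonnegative function which vanishes exactly on the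
boundary, where its differential is a positive multiple of the inward coordinate. It is a finite sum
of cut-off first coordinates of charts. -/
theorem exists_boundary_defining_function [T2Space M] [CompactSpace M] [IsManifold (𝓡∂ d) ∞ M]
    [RiemannianBundle (fun x : M => TangentSpace (𝓡∂ d) x)] :
    ∃ s : M → ℝ, ContMDiff (𝓡∂ d) 𝓘(ℝ, ℝ) ∞ s ∧ (∀ y, 0 ≤ s y) ∧
      (∀ y, s y = 0 ↔ y ∈ (𝓡∂ d).boundary M) ∧
      ∀ y ∈ (𝓡∂ d).boundary M, ∃ c : ℝ, 0 < c ∧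
        ∀ v, differential d s y v = c * inwardCoord d y v := by
  have ρ : ∀ x : M, SmoothBumpFunction (𝓡∂ d) x := fun x => Classical.arbitrary _
  obtain ⟨c, hc⟩ := exists_finite_plateau_cover ρ
  have hsm := fun x => contMDiff_bumpCoord (ρ x) 0
  have hnn := fun y => fun x (_ : x ∈ c) => bumpCoord_zero_nonneg (ρ x) y
  refine ⟨fun y => ∑ x ∈ c, bumpCoord (ρ x) 0 y, contMDiff_finsetSum fun x _ => hsm x,
    fun y => Finset.sum_nonneg (hnn y), fun y => ⟨fun h => ?_, fun hy => ?_⟩, fun y hy => ?_⟩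
  · obtain ⟨x, hx, hp⟩ := hc y
    have h0 := (Finset.sum_eq_zero_iff_of_nonneg (hnn y)).1 h x hx
    rw [(bumpCoord_eventuallyEq (ρ x) hp 0).self_of_nhds] at h0
    exact (extChartAt_zero_eq_zero_iff (plateau_subset_source _ hp)).1 h0
  · exact Finset.sum_eq_zero fun x _ => bumpCoord_zero_eq_zero (ρ x) hy
  · choose a ha hda using fun x => exists_differential_eq_mul_inwardCoord hy
      ((hsm x).mdifferentiableAt (by simp))
      fun y' => by rw [bumpCoord_zero_eq_zero (ρ x) hy]; exact bumpCoord_zero_nonneg (ρ x) y'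
    refine ⟨∑ x ∈ c, a x, ?_, fun v => ?_⟩
    · obtain ⟨x, hx, hp⟩ := hc y
      refine Finset.sum_pos' (fun x _ => ha x) ⟨x, hx, (ha x).lt_of_ne' fun h0 => ?_⟩
      refine differential_bumpCoord_ne_zero (ρ x) hp 0 ?_
      ext v
      rw [hda, h0, zero_mul]
      rfl
    · have hsum : differential d (fun y => ∑ x ∈ c, bumpCoord (ρ x) 0 y) y =
          ∑ x ∈ c, differential d (bumpCoord (ρ x) 0) y :=
        differential_finsetSum c fun x _ => (hsm x).mdifferentiableAt (by simp)
      rw [hsum, sum_apply, Finset.sum_mul]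
      exact Finset.sum_congr rfl fun x _ => hda x v

end Boundary

/-! ### Calibration inequality and the outward normal -/

section Calibration

variable {d : ℕ} [NeZero d]

theorem hasDerivAt_comp_curve {M : Type*} [TopologicalSpace M]
    [ChartedSpace (EuclideanHalfSpace d) M] {u : M → ℝ} {γ : ℝ → M} {t : ℝ}
    (hu : MDifferentiableAt (𝓡∂ d) 𝓘(ℝ, ℝ) u (γ t))
    (hγ : MDifferentiableAt 𝓘(ℝ, ℝ) (𝓡∂ d) γ t) :
    HasDerivAt (u ∘ γ) (differential d u (γ t) (mfderiv 𝓘(ℝ, ℝ) (𝓡∂ d) γ t 1)) t := by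
  have h : HasFDerivAt (u ∘ γ) ((differential d u (γ t)).comp
      (mfderiv 𝓘(ℝ, ℝ) (𝓡∂ d) γ t) : ℝ →L[ℝ] ℝ) t :=
    (hu.hasMFDerivAt.comp t hγ.hasMFDerivAt).hasFDerivAt
  exact h.hasDerivAt

variable {M : Type*} [MetricSpace M] [CompactSpace M]
  [ChartedSpace (EuclideanHalfSpace d) M]
  [IsManifold (𝓡∂ d) ∞ M] [RiemannianBundle (fun x : M => TangentSpace (𝓡∂ d) x)]

/-- The velocity of a curve is tangent to the boundary whenever the curve meets the boundary, since
a boundary defining function has a minimum along the curve at such a time. -/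
theorem mfderiv_curve_mem_boundaryTangent {γ : ℝ → M} {t : ℝ}
    (hγ : MDifferentiableAt 𝓘(ℝ, ℝ) (𝓡∂ d) γ t) (ht : γ t ∈ (𝓡∂ d).boundary M) :
    mfderiv 𝓘(ℝ, ℝ) (𝓡∂ d) γ t 1 ∈ boundaryTangent d (γ t) := by
  obtain ⟨s, hs, hs0, hsb, hds⟩ := exists_boundary_defining_function (d := d) (M := M)
  obtain ⟨c, hc, hcv⟩ := hds _ ht
  have hder := hasDerivAt_comp_curve ((hs (γ t)).mdifferentiableAt (by simp)) hγ
  have hmin : IsLocalMin (s ∘ γ) t := Filter.Eventually.of_forall fun t' => by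
    rw [Function.comp_apply, (hsb _).2 ht]
    exact hs0 _
  have h0 := hmin.hasDerivAt_eq_zero hder
  rw [hcv] at h0
  exact (mul_eq_zero.1 h0).resolve_left hc.ne'

variable [IsContinuousRiemannianBundle (EuclideanSpace ℝ (Fin d))
    (fun x : M => TangentSpace (𝓡∂ d) x)]
  [IsRiemannianManifold (𝓡∂ d) M]

/-- Calibration inequality: a `C¹` function whose differential is bounded by the Agmon weight, on
all vectors in the interior and on the vectors tangent to the boundary at boundary points, varies
by at most the Agmon distance. -/
theorem ofReal_sub_le_agmonDist {f φ : M → ℝ} (hφ : ContMDiff (𝓡∂ d) 𝓘(ℝ, ℝ) 1 φ)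
    (hint : ∀ x ∉ (𝓡∂ d).boundary M, ‖differential d φ x‖ ≤ ‖gradient d f x‖)
    (hbd : ∀ x ∈ (𝓡∂ d).boundary M, ∀ v ∈ boundaryTangent d x,
      |differential d φ x v| ≤ ‖tangentialGradient d f x‖ * ‖v‖) (x y : M) :
    ENNReal.ofReal (φ y - φ x) ≤ agmonDist d f x y := by
  refine le_iInf₂ fun γ hγ => ?_
  obtain ⟨⟨K, hK⟩, rfl, rfl⟩ := hγ
  obtain ⟨C, hC⟩ := exists_lipschitzWith (d := d) hφ
  have hL : LipschitzOnWith (C * K) (φ ∘ γ) (uIcc 0 1) := by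
    rw [uIcc_of_le zero_le_one]
    exact hC.comp_lipschitzOnWith hK
  calc ENNReal.ofReal (φ (γ 1) - φ (γ 0))
      = ENNReal.ofReal (∫ t in (0 : ℝ)..1, deriv (φ ∘ γ) t) := by
        rw [hL.absolutelyContinuousOnInterval.integral_deriv_eq_sub]
        rfl
    _ ≤ ‖∫ t in (0 : ℝ)..1, deriv (φ ∘ γ) t‖ₑ := by
        rw [← ofReal_norm]
        exact ENNReal.ofReal_le_ofReal (Real.le_norm_self _)
    _ ≤ ∫⁻ t in Ioo (0 : ℝ) 1, ‖deriv (φ ∘ γ) t‖ₑ := by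
        rw [intervalIntegral.integral_of_le zero_le_one, integral_Ioc_eq_integral_Ioo]
        exact enorm_integral_le_lintegral_enorm _
    _ ≤ agmonLength d f γ (Ioo 0 1) := by
        refine lintegral_mono_ae ?_
        rw [ae_restrict_iff' measurableSet_Ioo]
        filter_upwards [ae_mdifferentiableAt_of_lipschitzOnWith (d := d) hK] with t ht h
        have hγt := ht h
        rw [(hasDerivAt_comp_curve ((hφ (γ t)).mdifferentiableAt one_ne_zero) hγt).deriv,
          ← ofReal_norm, Real.norm_eq_abs]
        refine ENNReal.ofReal_le_ofReal ?_
        by_cases hb : γ t ∈ (𝓡∂ d).boundary M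
        · rw [agmonWeight, if_pos hb]
          exact hbd _ hb _ (mfderiv_curve_mem_boundaryTangent hγt hb)
        · rw [agmonWeight, if_neg hb]
          refine (ContinuousLinearMap.le_opNorm (differential d φ (γ t)) _).trans ?_
          gcongr
          exact hint _ hb

end Calibration

section Normal

variable {d : ℕ} [NeZero d] {M : Type*} [TopologicalSpace M]
  [ChartedSpace (EuclideanHalfSpace d) M]
  [RiemannianBundle (fun x : M => TangentSpace (𝓡∂ d) x)]

theorem inner_gradient (f : M → ℝ) (x : M) (v : TangentSpace (𝓡∂ d) x) :
    ⟪gradient d f x, v⟫_ℝ = differential d f x v :=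
  InnerProductSpace.toDual_symm_apply

theorem norm_gradient (f : M → ℝ) (x : M) : ‖gradient d f x‖ = ‖differential d f x‖ :=
  LinearIsometryEquiv.norm_map _ _

variable [IsManifold (𝓡∂ d) ∞ M]

theorem isOutwardUnitNormal_outwardNormal (x : M) :
    IsOutwardUnitNormal d x (outwardNormal d x) :=
  (existsUnique_outwardUnitNormal d x).choose_spec.1

theorem inwardCoord_eq_mul_inner_outwardNormal (x : M) (v : TangentSpace (𝓡∂ d) x) :
    inwardCoord d x v = inwardCoord d x (outwardNormal d x) * ⟪v, outwardNormal d x⟫_ℝ := by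
  obtain ⟨h1, h2, h3⟩ := isOutwardUnitNormal_outwardNormal (d := d) x
  set n := outwardNormal d x
  have hk : v - (inwardCoord d x v / inwardCoord d x n) • n ∈ boundaryTangent d x := by
    change inwardCoord d x _ = 0
    rw [map_sub, map_smul, smul_eq_mul, div_mul_cancel₀ _ h3.ne, sub_self]
  have h := h2 _ hk
  rw [inner_sub_right, real_inner_smul_right, real_inner_self_eq_norm_sq, h1, one_pow, mul_one,
    sub_eq_zero, real_inner_comm] at h
  rw [h, mul_div_cancel₀ _ h3.ne]

/-- On vectors tangent to the boundary, `f` has the same derivative as in the direction of its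
tangential gradient. -/
theorem abs_differential_le_norm_tangentialGradient (f : M → ℝ) (x : M)
    {v : TangentSpace (𝓡∂ d) x} (hv : v ∈ boundaryTangent d x) :
    |differential d f x v| ≤ ‖tangentialGradient d f x‖ * ‖v‖ := by
  have h : differential d f x v = ⟪tangentialGradient d f x, v⟫_ℝ := by
    rw [tangentialGradient, inner_sub_left, real_inner_smul_left,
      (isOutwardUnitNormal_outwardNormal x).orthogonal v hv, mul_zero, sub_zero, inner_gradient]
  rw [h]
  exact abs_real_inner_le_norm _ _

end Normal

/-! ### The perturbation and its differential -/

section Auxiliary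

/-- Two continuous functions without a common nonpositive point on a compact set are not small
simultaneously, quantitatively. -/
theorem exists_pos_forall_le_of_isCompact {X : Type*} [TopologicalSpace X] {K : Set X}
    (hK : IsCompact K) {s u : X → ℝ} (hs : Continuous s) (hu : Continuous u)
    (h : ∀ x ∈ K, s x ≤ 0 → 0 < u x) :
    ∃ τ : ℝ, 0 < τ ∧ ∀ x ∈ K, s x ≤ τ → τ ≤ u x := by
  rcases K.eq_empty_or_nonempty with rfl | hne
  · exact ⟨1, one_pos, fun x hx => hx.elim⟩
  obtain ⟨x₀, hx₀, hmin⟩ := hK.exists_isMinOn hne (hs.max hu).continuousOn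
  have hpos : 0 < max (s x₀) (u x₀) := by
    rcases le_or_gt (s x₀) 0 with h0 | h0
    · exact lt_max_of_lt_right (h x₀ hx₀ h0)
    · exact lt_max_of_lt_left h0
  refine ⟨max (s x₀) (u x₀) / 2, half_pos hpos, fun x hx hsx => ?_⟩
  have hle : max (s x₀) (u x₀) ≤ max (s x) (u x) := hmin hx
  rcases le_max_iff.1 hle with h' | h' <;> linarith

/-- The square of the positive part, a `C¹` function. -/
def posSq (x : ℝ) : ℝ := max x 0 ^ 2

theorem posSq_nonneg (x : ℝ) : 0 ≤ posSq x := sq_nonneg _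

theorem posSq_of_nonpos {x : ℝ} (hx : x ≤ 0) : posSq x = 0 := by
  rw [posSq, max_eq_right hx, zero_pow two_ne_zero]

theorem hasDerivAt_posSq (x : ℝ) : HasDerivAt posSq (2 * max x 0) x := by
  rcases lt_trichotomy x 0 with hx | rfl | hx
  · rw [max_eq_right hx.le, mul_zero]
    refine (hasDerivAt_const x (0 : ℝ)).congr_of_eventuallyEq ?_
    filter_upwards [eventually_lt_nhds hx] with y hy using posSq_of_nonpos hy.le
  · rw [max_self, mul_zero, hasDerivAt_iff_isLittleO_nhds_zero]
    refine Asymptotics.IsBigO.trans_isLittleO (g := fun h : ℝ => h ^ 2) ?_ ?_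
    · refine Asymptotics.IsBigO.of_bound 1 (Filter.Eventually.of_forall fun h => ?_)
      simp only [posSq, zero_add, max_self, smul_zero, sub_zero, one_mul, norm_pow, Real.norm_eq_abs,
        zero_pow two_ne_zero]
      refine pow_le_pow_left₀ (abs_nonneg _) ?_ 2
      rw [abs_of_nonneg (le_max_right h 0)]
      exact max_le (le_abs_self h) (abs_nonneg h)
    · simpa using Asymptotics.isLittleO_pow_pow (𝕜 := ℝ) one_lt_two
  · rw [max_eq_left hx.le]
    have h : HasDerivAt (fun y : ℝ => y ^ 2) (2 * x) x := by simpa using hasDerivAt_pow 2 x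
    refine h.congr_of_eventuallyEq ?_
    filter_upwards [eventually_gt_nhds hx] with y hy
    rw [posSq, max_eq_left hy.le]

theorem contDiff_posSq : ContDiff ℝ 1 posSq := by
  rw [contDiff_one_iff_deriv]
  refine ⟨fun x => (hasDerivAt_posSq x).differentiableAt, ?_⟩
  rw [funext fun x => (hasDerivAt_posSq x).deriv]
  fun_prop

/-- The bound on the gradient of the calibrating potential: moving `k • g` slightly in a direction at
an obtuse angle to `g` does not increase the norm. -/
theorem norm_smul_add_smul_le {E : Type*} [NormedAddCommGroup E] [InnerProductSpace ℝ E]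
    {g w : E} {k a m : ℝ} (hk : 1 / 2 ≤ k) (hk1 : k ≤ 1) (ha : 0 ≤ a)
    (hgw : ⟪w, g⟫_ℝ ≤ -m) (hm : 0 ≤ m) (hw : a * ‖w‖ ^ 2 ≤ m) :
    ‖k • g + a • w‖ ≤ ‖g‖ := by
  refine le_of_sq_le_sq ?_ (norm_nonneg _)
  rw [norm_add_sq_real, real_inner_smul_left, real_inner_smul_right, norm_smul, norm_smul,
    real_inner_comm, mul_pow, mul_pow, Real.norm_eq_abs, Real.norm_eq_abs, sq_abs, sq_abs]
  have h1 : k ^ 2 * ‖g‖ ^ 2 ≤ ‖g‖ ^ 2 :=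
    mul_le_of_le_one_left (sq_nonneg _) (by nlinarith)
  have h2 : k * ⟪w, g⟫_ℝ ≤ -m / 2 := by nlinarith
  have h3 : a * (2 * (k * ⟪w, g⟫_ℝ) + a * ‖w‖ ^ 2) ≤ 0 :=
    mul_nonpos_of_nonneg_of_nonpos ha (by linarith)
  nlinarith

end Auxiliary

section Potential

variable {d : ℕ} [NeZero d] {M : Type*} [TopologicalSpace M]
  [ChartedSpace (EuclideanHalfSpace d) M]

theorem contMDiffAt_perturbation {f s : M → ℝ} {x : M}
    (hf : ContMDiffAt (𝓡∂ d) 𝓘(ℝ, ℝ) 1 f x) (hs : ContMDiffAt (𝓡∂ d) 𝓘(ℝ, ℝ) 1 s x)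
    (δ e θ : ℝ) :
    ContMDiffAt (𝓡∂ d) 𝓘(ℝ, ℝ) 1
      (fun y => f y + -posSq ((δ - s y) + -(θ * posSq (e - f y)))) x := by
  have hp := fun y => (contDiff_posSq.contDiffAt (x := y)).contMDiffAt
  have h1 : ContMDiffAt (𝓡∂ d) 𝓘(ℝ, ℝ) 1 (fun y => posSq (e - f y)) x :=
    ContMDiffAt.comp x (hp _) (contMDiffAt_const.sub hf)
  have h2 : ContMDiffAt (𝓡∂ d) 𝓘(ℝ, ℝ) 1
      (fun y => posSq ((δ - s y) + -(θ * posSq (e - f y)))) x :=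
    ContMDiffAt.comp x (hp _) ((contMDiffAt_const.sub hs).add (contMDiffAt_const.mul h1).neg)
  exact hf.add h2.neg

variable [IsManifold (𝓡∂ d) ∞ M] [RiemannianBundle (fun x : M => TangentSpace (𝓡∂ d) x)]

/-- By polarization this follows from the continuity of the norms of the differentials. -/
theorem continuous_inner_gradient
    [IsContinuousRiemannianBundle (EuclideanSpace ℝ (Fin d))
      (fun x : M => TangentSpace (𝓡∂ d) x)] {u v : M → ℝ}
    (hu : ContMDiff (𝓡∂ d) 𝓘(ℝ, ℝ) 1 u) (hv : ContMDiff (𝓡∂ d) 𝓘(ℝ, ℝ) 1 v) :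
    Continuous (fun x => ⟪gradient d u x, gradient d v x⟫_ℝ) := by
  have h : ∀ x, ⟪gradient d u x, gradient d v x⟫_ℝ =
      (‖differential d (fun y => u y + v y) x‖ ^ 2 - ‖differential d u x‖ ^ 2 -
        ‖differential d v x‖ ^ 2) / 2 := by
    intro x
    have hg : gradient d (fun y => u y + v y) x = gradient d u x + gradient d v x := by
      rw [gradient, differential_add ((hu x).mdifferentiableAt one_ne_zero)
        ((hv x).mdifferentiableAt one_ne_zero), map_add]
      rfl
    rw [← norm_gradient, ← norm_gradient, ← norm_gradient, hg, norm_add_sq_real]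
    ring
  simp only [h]
  have h1 := continuous_norm_differential (hu.add hv)
  have h2 := continuous_norm_differential hu
  have h3 := continuous_norm_differential hv
  exact ((((h1.pow 2).sub (h2.pow 2)).sub (h3.pow 2)).div_const 2)

/-- The differential of `f - ((δ - s - θ ((e - f)₊)²)₊)²` as a combination of those of `f` and
`s`. -/
theorem differential_perturbation {f s : M → ℝ} {x : M}
    (hf : MDifferentiableAt (𝓡∂ d) 𝓘(ℝ, ℝ) f x) (hs : MDifferentiableAt (𝓡∂ d) 𝓘(ℝ, ℝ) s x)
    (δ e θ : ℝ) :
    differential d (fun y => f y + -posSq ((δ - s y) + -(θ * posSq (e - f y)))) x =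
      (1 - 2 * max ((δ - s x) + -(θ * posSq (e - f x))) 0 * (θ * (2 * max (e - f x) 0))) •
          differential d f x +
        (2 * max ((δ - s x) + -(θ * posSq (e - f x))) 0) • differential d s x := by
  have h1 : HasDerivAt (fun r => δ - r) (-1) (s x) := by
    simpa using (hasDerivAt_id (s x)).const_sub δ
  have h2 : HasDerivAt (fun r => -(θ * posSq (e - r))) (θ * (2 * max (e - f x) 0)) (f x) := by
    have h : HasDerivAt (fun r => posSq (e - r)) (2 * max (e - f x) 0 * -1) (f x) :=
      (hasDerivAt_posSq (e - f x)).comp (f x) (by simpa using (hasDerivAt_id (f x)).const_sub e)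
    exact (h.const_mul θ).neg.congr_deriv (by ring)
  have h3 := fun r => (hasDerivAt_posSq r).neg
  have d1 : MDifferentiableAt (𝓡∂ d) 𝓘(ℝ, ℝ) (fun y => δ - s y) x :=
    MDifferentiableAt.comp (g := fun r => δ - r) x h1.differentiableAt.mdifferentiableAt hs
  have d2 : MDifferentiableAt (𝓡∂ d) 𝓘(ℝ, ℝ) (fun y => -(θ * posSq (e - f y))) x :=
    MDifferentiableAt.comp (g := fun r => -(θ * posSq (e - r))) x h2.differentiableAt.mdifferentiableAt hf
  have d3 : MDifferentiableAt (𝓡∂ d) 𝓘(ℝ, ℝ)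
      (fun y => (δ - s y) + -(θ * posSq (e - f y))) x := d1.add d2
  have d4 : MDifferentiableAt (𝓡∂ d) 𝓘(ℝ, ℝ)
      (fun y => -posSq ((δ - s y) + -(θ * posSq (e - f y)))) x :=
    MDifferentiableAt.comp (g := fun r => -posSq r) x (h3 _).differentiableAt.mdifferentiableAt d3
  have e3 := differential_comp_of_hasDerivAt (h3 _) d3
  simp only [Pi.neg_apply] at e3
  rw [differential_add hf d4, e3, differential_add d1 d2,
    differential_comp_of_hasDerivAt h1 hs, differential_comp_of_hasDerivAt h2 hf]
  module

/-- The gradient of a boundary defining function makes an obtuse angle with the gradient of `f` on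
the boundary, as the normal derivative of `f` is positive there. -/
theorem inner_gradient_neg_of_boundary {f s : M → ℝ} (h3 : HypH3 d f) {x : M}
    (hx : x ∈ (𝓡∂ d).boundary M) {c : ℝ} (hc : 0 < c)
    (hs : ∀ v, differential d s x v = c * inwardCoord d x v) :
    ⟪gradient d s x, gradient d f x⟫_ℝ < 0 := by
  rw [inner_gradient, hs, inwardCoord_eq_mul_inner_outwardNormal]
  exact mul_neg_of_pos_of_neg hc (mul_neg_of_neg_of_pos
    (isOutwardUnitNormal_outwardNormal x).outward (h3 x hx))

end Potential

/-! ### The calibrating potential -/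

section BarrierPotential

variable {d : ℕ} [NeZero d] {M : Type*} [MetricSpace M] [CompactSpace M]
  [ChartedSpace (EuclideanHalfSpace d) M]
  [IsManifold (𝓡∂ d) ∞ M] [RiemannianBundle (fun x : M => TangentSpace (𝓡∂ d) x)]

/-- The calibrating potential: `f - ((δ - s - η)₊)²`, where `s` is a boundary defining function and
`η = ((f z + ε - f)₊)²` on a small ball around the strict local minimum `z` of `f` on the boundary,
and `η = 0` outside this ball. -/
theorem exists_calibration [IsContinuousRiemannianBundle (EuclideanSpace ℝ (Fin d))
      (fun x : M => TangentSpace (𝓡∂ d) x)]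
    {f : M → ℝ} (hf : ContMDiff (𝓡∂ d) 𝓘(ℝ, ℝ) ∞ f) (h3 : HypH3 d f) {w z : M}
    (hw : w ∈ (𝓡∂ d).boundary M) (hz : z ∈ (𝓡∂ d).boundary M) (hwz : w ≠ z)
    (hstrict : ∀ᶠ y in 𝓝 z, y ∈ (𝓡∂ d).boundary M → y ≠ z → f z < f y) :
    ∃ φ : M → ℝ, ContMDiff (𝓡∂ d) 𝓘(ℝ, ℝ) 1 φ ∧
      (∀ x, ‖differential d φ x‖ ≤ ‖gradient d f x‖) ∧
      (∀ x ∈ (𝓡∂ d).boundary M, ∀ v ∈ boundaryTangent d x,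
        |differential d φ x v| ≤ ‖tangentialGradient d f x‖ * ‖v‖) ∧
      f z - f w < φ z - φ w := by
  obtain ⟨s, hs, hs0, hsb, hds⟩ := exists_boundary_defining_function (d := d) (M := M)
  have hf1 : ContMDiff (𝓡∂ d) 𝓘(ℝ, ℝ) 1 f := hf.of_le (by simp)
  have hs1 : ContMDiff (𝓡∂ d) 𝓘(ℝ, ℝ) 1 s := hs.of_le (by simp)
  -- On the sphere bounding the ball, `f > f z` at boundary points, hence near the boundary.
  obtain ⟨r₀, hr₀, hball⟩ := Metric.eventually_nhds_iff.1 hstrict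
  obtain ⟨r, hr, hrr₀, hrw⟩ : ∃ r : ℝ, 0 < r ∧ r < r₀ ∧ r ≤ dist w z :=
    ⟨min (r₀ / 2) (dist w z), lt_min (by linarith) (dist_pos.2 hwz),
      (min_le_left _ _).trans_lt (by linarith), min_le_right _ _⟩
  obtain ⟨τ, hτ, hsphere⟩ := exists_pos_forall_le_of_isCompact (isCompact_sphere z r)
    hs.continuous (u := fun y => f y - f z) (hf.continuous.sub continuous_const)
    fun y hy hsy => by
      have hdist : dist y z = r := hy
      refine sub_pos.2 (hball (by rw [hdist]; exact hrr₀)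
        ((hsb y).1 (le_antisymm hsy (hs0 y))) fun h => ?_)
      rw [h, dist_self] at hdist
      exact hr.ne hdist
  -- Near the boundary the gradients of `s` and `f` make an angle uniformly greater than `π / 2`.
  obtain ⟨m, hm, hcollar⟩ := exists_pos_forall_le_of_isCompact (isCompact_univ (X := M))
    hs.continuous (continuous_inner_gradient hs1 hf1).neg
    fun y _ hsy => by
      have hy := (hsb y).1 (le_antisymm hsy (hs0 y))
      obtain ⟨c, hc, hcv⟩ := hds y hy
      exact neg_pos.2 (inner_gradient_neg_of_boundary h3 hy hc hcv)
  obtain ⟨C, hC0, hC⟩ : ∃ C : ℝ, 0 < C ∧ ∀ x, ‖gradient d s x‖ ^ 2 ≤ C := by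
    obtain ⟨C, hC⟩ := (isCompact_univ (X := M)).bddAbove_image
      ((continuous_norm_differential hs1).pow 2).continuousOn
    refine ⟨max C 1, by positivity, fun x => le_max_of_le_left ?_⟩
    rw [norm_gradient]
    exact hC ⟨x, mem_univ x, rfl⟩
  set e : ℝ := f z + τ / 2 with he
  obtain ⟨B, hB0, hB⟩ : ∃ B : ℝ, 0 < B ∧ ∀ x, 2 * max (e - f x) 0 ≤ B := by
    obtain ⟨B, hB⟩ := (isCompact_univ (X := M)).bddAbove_image
      (f := fun x => 2 * max (e - f x) 0)
      ((continuous_const.sub hf.continuous).max continuous_const |>.const_mul 2).continuousOn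
    exact ⟨max B 1, by positivity, fun x => le_max_of_le_left (hB ⟨x, mem_univ x, rfl⟩)⟩
  -- `δ ≤ τ` gives `φ = f` across the sphere away from the boundary, `δ ≤ m` confines the
  -- perturbation to the collar, and the last two conditions are those on the coefficients of `dφ`.
  obtain ⟨δ, hδ, hδτ, hδm, hδC, hδB⟩ : ∃ δ : ℝ, 0 < δ ∧ δ ≤ τ ∧ δ ≤ m ∧ 2 * δ * C ≤ m ∧
      2 * δ * B ≤ 1 / 2 := by
    refine ⟨min (min τ m) (min (m / (2 * C)) (1 / (4 * B))), by positivity,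
      (min_le_left _ _).trans (min_le_left _ _), (min_le_left _ _).trans (min_le_right _ _), ?_, ?_⟩
    · have h := (min_le_right (min τ m) (min (m / (2 * C)) (1 / (4 * B)))).trans (min_le_left _ _)
      rw [le_div_iff₀ (by positivity)] at h
      linarith
    · have h := (min_le_right (min τ m) (min (m / (2 * C)) (1 / (4 * B)))).trans (min_le_right _ _)
      rw [le_div_iff₀ (by positivity)] at h
      linarith
  classical
  let η : M → ℝ := fun y => if dist y z < r then posSq (e - f y) else 0
  have hη0 : ∀ y, 0 ≤ η y := fun y => by
    simp only [η]
    split_ifs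
    exacts [posSq_nonneg _, le_rfl]
  let φ : M → ℝ := fun y => f y + -posSq ((δ - s y) + -η y)
  -- Across the sphere, `η` vanishes near the boundary, and away from it `φ = f` on both sides.
  have hlocal : ∀ x, (φ =ᶠ[𝓝 x] f) ∨ ∃ θ : ℝ, 0 ≤ θ ∧ θ ≤ 1 ∧
      φ =ᶠ[𝓝 x] fun y => f y + -posSq ((δ - s y) + -(θ * posSq (e - f y))) := by
    intro x
    have hdist : Continuous fun y => dist y z := continuous_id.dist continuous_const
    rcases lt_trichotomy (dist x z) r with hx | hx | hx
    · refine Or.inr ⟨1, zero_le_one, le_rfl, ?_⟩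
      filter_upwards [hdist.continuousAt.eventually_lt_const hx] with y hy
      simp only [φ, η, if_pos hy, one_mul]
    · rcases le_or_gt (s x) τ with hsx | hsx
      · have hfx : e < f x := by
          have h := hsphere x hx hsx
          rw [he]
          linarith
        refine Or.inr ⟨0, le_rfl, zero_le_one, ?_⟩
        filter_upwards [hf.continuous.continuousAt.eventually_const_lt hfx] with y hy
        have hy0 : posSq (e - f y) = 0 := posSq_of_nonpos (by linarith)
        simp only [φ, η, hy0, ite_self, mul_zero]
      · refine Or.inl ?_
        filter_upwards [hs.continuous.continuousAt.eventually_const_lt hsx] with y hy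
        have h := hη0 y
        simp only [φ, posSq_of_nonpos (show (δ - s y) + -η y ≤ 0 by linarith), neg_zero, add_zero]
    · refine Or.inr ⟨0, le_rfl, zero_le_one, ?_⟩
      filter_upwards [hdist.continuousAt.eventually_const_lt hx] with y hy
      simp only [φ, η, if_neg hy.not_gt, zero_mul]
  have hcoef : ∀ x, ∃ k a : ℝ, 1 / 2 ≤ k ∧ k ≤ 1 ∧ 0 ≤ a ∧ a ≤ 2 * δ ∧ (a ≠ 0 → s x ≤ m) ∧
      differential d φ x = k • differential d f x + a • differential d s x := by
    intro x
    have hfx := (hf1 x).mdifferentiableAt one_ne_zero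
    have hsx := (hs1 x).mdifferentiableAt one_ne_zero
    rcases hlocal x with h | ⟨θ, hθ, hθ1, h⟩
    · refine ⟨1, 0, by norm_num, le_rfl, le_rfl, by positivity, fun h0 => absurd rfl h0, ?_⟩
      rw [one_smul, zero_smul, add_zero]
      exact h.mfderiv_eq
    · have hd : differential d φ x = _ :=
        h.mfderiv_eq.trans (differential_perturbation hfx hsx δ e θ)
      set g := (δ - s x) + -(θ * posSq (e - f x)) with hg
      have hgs : g ≤ δ - s x := by
        have := mul_nonneg hθ (posSq_nonneg (e - f x))
        linarith
      have hgδ : max g 0 ≤ δ := max_le (by linarith [hs0 x]) hδ.le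
      have hg0 : 0 ≤ max g 0 := le_max_right _ _
      have hb0 : 0 ≤ 2 * max (e - f x) 0 := by positivity
      have hprod : 2 * max g 0 * (θ * (2 * max (e - f x) 0)) ≤ 2 * δ * B := by
        have h1 : θ * (2 * max (e - f x) 0) ≤ B :=
          (mul_le_of_le_one_left hb0 hθ1).trans (hB x)
        have h2 : 0 ≤ θ * (2 * max (e - f x) 0) := mul_nonneg hθ hb0
        exact mul_le_mul (by linarith) h1 h2 (by positivity)
      have hprod0 : 0 ≤ 2 * max g 0 * (θ * (2 * max (e - f x) 0)) := by positivity
      refine ⟨_, _, by linarith, by linarith, by positivity, by linarith, fun h0 => ?_, hd⟩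
      by_contra hsm
      push Not at hsm
      exact h0 (by rw [max_eq_right (by linarith), mul_zero])
  refine ⟨φ, fun x => ?_, fun x => ?_, fun x hx v hv => ?_, ?_⟩
  · rcases hlocal x with h | ⟨θ, -, -, h⟩
    · exact (hf1 x).congr_of_eventuallyEq h
    · exact (contMDiffAt_perturbation (hf1 x) (hs1 x) δ e θ).congr_of_eventuallyEq h
  · obtain ⟨k, a, hk, hk1, ha, haδ, has, hd⟩ := hcoef x
    have hgrad : gradient d φ x = k • gradient d f x + a • gradient d s x := by
      rw [gradient, hd, map_add, map_smul, map_smul]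
      rfl
    rw [← norm_gradient, hgrad]
    rcases eq_or_ne a 0 with rfl | ha0
    · rw [zero_smul, add_zero, norm_smul, Real.norm_of_nonneg (by linarith)]
      exact mul_le_of_le_one_left (norm_nonneg _) hk1
    · refine norm_smul_add_smul_le hk hk1 ha ?_ hm.le ?_
      · exact le_neg.1 (hcollar x (mem_univ x) (has ha0))
      · exact (mul_le_mul haδ (hC x) (sq_nonneg _) (by positivity)).trans hδC
  · obtain ⟨k, a, hk, hk1, -, -, -, hd⟩ := hcoef x
    obtain ⟨c, -, hcv⟩ := hds x hx
    have hv0 : inwardCoord d x v = 0 := hv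
    have hdv : differential d φ x v = k * differential d f x v := by
      rw [hd]
      change k * differential d f x v + a * differential d s x v = _
      rw [hcv, hv0, mul_zero, mul_zero, add_zero]
    rw [hdv, abs_mul, abs_of_nonneg (by linarith)]
    exact (mul_le_of_le_one_left (abs_nonneg _) hk1).trans
      (abs_differential_le_norm_tangentialGradient f x hv)
  · have hηz : η z = (τ / 2) ^ 2 := by
      simp only [η, dist_self, if_pos hr, he, add_sub_cancel_left, posSq]
      rw [max_eq_left (by positivity)]
    have hηw : η w = 0 := if_neg hrw.not_gt
    have hφw : φ w = f w - δ ^ 2 := by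
      simp only [φ, hηw, (hsb w).2 hw, posSq]
      rw [max_eq_left (by linarith)]
      ring
    have hφz : f z - δ ^ 2 < φ z := by
      simp only [φ, hηz, (hsb z).2 hz, posSq]
      have h : max (δ - 0 + -(τ / 2) ^ 2) 0 < δ := max_lt (by nlinarith) hδ
      have := pow_lt_pow_left₀ h (le_max_right _ _) two_ne_zero
      linarith
    linarith

end BarrierPotential

/-- If the local minima of `f` on the set `s` are finitely many, then they are strict: the points
near `z` where `f` takes the value `f z` are local minima as well. -/
theorem eventually_lt_of_finite_isLocalMinOn {X : Type*} [TopologicalSpace X] [T1Space X]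
    {f : X → ℝ} {s : Set X} (hfin : {y | y ∈ s ∧ IsLocalMinOn f s y}.Finite) {z : X}
    (hmin : IsLocalMinOn f s z) :
    ∀ᶠ y in 𝓝 z, y ∈ s → y ≠ z → f z < f y := by
  have h1 : ∀ᶠ y in 𝓝 z, y ∈ s → f z ≤ f y := eventually_nhdsWithin_iff.1 hmin
  have h2 : ∀ᶠ y in 𝓝 z, y ∉ {y | y ∈ s ∧ IsLocalMinOn f s y} \ {z} :=
    (hfin.subset sdiff_subset).isClosed.isOpen_compl.mem_nhds fun h => h.2 rfl
  filter_upwards [h1.eventually_nhds, h2] with y hy hy2 hys hyz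
  refine lt_of_le_of_ne (hy.self_of_nhds hys) fun heq => hy2 ⟨⟨hys, ?_⟩, hyz⟩
  refine eventually_nhdsWithin_iff.2 ?_
  filter_upwards [hy] with y' hy' hys'
  rw [← heq]
  exact hy' hys'

end Agmon

theorem mainTheorem10
    {d : ℕ} [NeZero d] {M : Type*} [MetricSpace M] [CompactSpace M] [ConnectedSpace M]
    [ChartedSpace (EuclideanHalfSpace d) M] [IsManifold (𝓡∂ d) ∞ M]
    [RiemannianBundle (fun x : M => TangentSpace (𝓡∂ d) x)]
    [IsContMDiffRiemannianBundle (𝓡∂ d) ∞ (EuclideanSpace ℝ (Fin d))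
      (fun x : M => TangentSpace (𝓡∂ d) x)]
    [IsRiemannianManifold (𝓡∂ d) M]
    (f : M → ℝ) (hf : ContMDiff (𝓡∂ d) 𝓘(ℝ, ℝ) ∞ f)
    (h1 : Agmon.HypH1 d f) (h3 : Agmon.HypH3 d f)
    (n : ℕ) (z : Fin n → M) (hz_inj : Function.Injective z)
    (hz_range : Set.range z = Agmon.boundaryLocalMinima d f)
    (hz_mono : Monotone (fun i => f (z i))) :
    ∀ i j : Fin n, i < j →
      ENNReal.ofReal (f (z j) - f (z i)) < Agmon.agmonDist d f (z i) (z j) := by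
  intro i j hij
  have : IsContinuousRiemannianBundle (EuclideanSpace ℝ (Fin d))
      (fun x : M => TangentSpace (𝓡∂ d) x) := by
    obtain ⟨g, hg, hgv⟩ := IsContMDiffRiemannianBundle.exists_contMDiff (IB := 𝓡∂ d) (n := ∞)
      (F := EuclideanSpace ℝ (Fin d)) (E := fun x : M => TangentSpace (𝓡∂ d) x)
    exact ⟨g, hg.continuous, hgv⟩
  have hmem : ∀ k, z k ∈ Agmon.boundaryLocalMinima d f := fun k => hz_range ▸ mem_range_self k
  have hfin : (Agmon.boundaryLocalMinima d f).Finite := hz_range ▸ finite_range z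
  obtain ⟨φ, hφ, hint, hbd, hlt⟩ := Agmon.exists_calibration hf h3 (hmem i).1 (hmem j).1
    (hz_inj.ne hij.ne) (Agmon.eventually_lt_of_finite_isLocalMinOn hfin (hmem j).2)
  have hle : f (z i) ≤ f (z j) := hz_mono hij.le
  exact ((ENNReal.ofReal_lt_ofReal_iff (by linarith)).2 hlt).trans_le
    (Agmon.ofReal_sub_le_agmonDist hφ (fun x _ => hint x) hbd (z i) (z j))
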